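/- Let $1\le n\le 3$, let $\Omega\subset\mathbb R^n$ be a bounded domain with locally Lipschitz boundary, and let $d_1,d_2,a,b,D_1,D_2>0$. Put $H=L^2(\Omega)^4$ and consider, for $t>0$ and $x\in\Omega$, the coupled Brusselator system $$\begin{aligned} u_t&=d_1\Delta u+a-(b+1)u+u^2v+D_1(w-u), & v_t&=d_2\Delta v+bu-u^2v+D_2(z-v),\\ w_t&=d_1\Delta w+a-(b+1)w+w^2z+D_1(u-w), & z_t&=d_2\Delta z+bw-w^2z+D_2(v-z), \end{aligned}$$ with $u=v=w=z=0$ on $\partial\Omega$. Let $\{S(t)\}_{t\ge0}$ be the solution semiflow of this system on $H$: a semigroup of continuous maps $S(t):H\to H$ such that, for each $g_0\in H$, the map $t\mapsto S(t)g_0=(u(t),v(t),w(t),z(t))$ is a global strong solution with initial value $g_0$. Here a global strong solution is a function in $C([0,\infty);H)\cap C^1((0,\infty);H)\cap L^2(0,T;H^1_0(\Omega)^4)$ for all $T>0$ whose components lie, for each $t>0$, in $H_0^1(\Omega)$ with weak Laplacian in $L^2(\Omega)$, and which satisfies the equations in $H$ for each $t>0$. For a subset $B$ of a Banach space let $\kappa(B)$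 be its Kuratowski measure of noncompactness, that is, the infimum of all $\delta$ such that $B$ has a finite cover by open sets of diameters $<\delta$ (with $\kappa(B)=\infty$ if $B$ is unbounded). Suppose that: (i) There is a bounded absorbing set $B_0\subset H$: a bounded set such that for each bounded $B\subset H$ there is $t_0\ge0$ with $S(t)B\subset B_0$ for all $t>t_0$. (ii) There are constants $L_1,L_2>0$ such that for each $\varepsilon>0$ there are $M,T>0$ with $$\int_{\{|v(t)|\ge M\}}|v(t)|^2\,dx+\int_{\{|z(t)|\ge M\}}|z(t)|^2\,dx<L_1\varepsilon,\qquad \int_{\{|v(t)|\ge M\}}|u(t)|^2\,dx+\int_{\{|z(t)|\ge M\}}|w(t)|^2\,dx<L_2\varepsilon$$ for all $t>T$ and all $g_0\in B_0$, where $(u(t),v(t),w(t),z(t))=S(t)g_0$. (iii) For each $M>0$, as $t\to\infty$, $$\kappa\Big(\big\{(u(t),v(t))\,\mathbf 1_{\{|v(t)|<M\}}:g_0\in B_0\big\}\Big)\to0\quad\text{and}\quad \kappa\Big(\big\{(w(t),z(t))\,\mathbf 1_{\{|z(t)|<M\}}:g_0\in B_0\big\}\Big)\to0,$$ where $\kappa$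 is taken in $L^2(\Omega)\times L^2(\Omega)$. Then the semiflow has a global attractor in $H$: a nonempty compact set $\mathscr A\subset H$ with $S(t)\mathscr A=\mathscr A$ for all $t\ge0$ and $\lim_{t\to\infty}\sup_{x\in S(t)B}\inf_{y\in\mathscr A}\|x-y\|_H=0$ for each bounded $B\subset H$. -/

import Mathlib

open Filter Topology Set MeasureTheory
open scoped ENNReal

noncomputable section

namespace Brusselator

/-! ### Semiflows, absorbing sets, global attractors, Kuratowski measure -/

section Dynamics

variable {X : Type*} [NormedAddCommGroup X]

/-- A semiflow `{S(t)}_{t ≥ 0}`: a semigroup of continuous maps whose orbits are continuous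
in time. Values of `S` at negative times are irrelevant. -/
structure IsSemiflow (S : ℝ → X → X) : Prop where
  map_zero : ∀ x, S 0 x = x
  map_add : ∀ s t, 0 ≤ s → 0 ≤ t → ∀ x, S (s + t) x = S s (S t x)
  continuous_space : ∀ t, 0 ≤ t → Continuous (S t)
  continuous_time : ∀ x, ContinuousOn (fun t => S t x) (Ici 0)

/-- `B₀` is a bounded absorbing set. -/
def IsAbsorbing (S : ℝ → X → X) (B₀ : Set X) : Prop :=
  Bornology.IsBounded B₀ ∧
    ∀ B : Set X, Bornology.IsBounded B → ∃ t₀ : ℝ, 0 ≤ t₀ ∧ ∀ t, t₀ < t → S t '' B ⊆ B₀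

/-- `A` is a global attractor: nonempty, compact, invariant, and attracting every bounded set
with respect to the Hausdorff semidistance. -/
structure IsGlobalAttractor (S : ℝ → X → X) (A : Set X) : Prop where
  nonempty : A.Nonempty
  isCompact : IsCompact A
  invariant : ∀ t, 0 ≤ t → S t '' A = A
  attracts : ∀ B : Set X, Bornology.IsBounded B →
    Tendsto (fun t : ℝ => ⨆ x ∈ S t '' B, Metric.infEDist x A) atTop (𝓝 0)

/-- The Kuratowski measure of noncompactness: the infimum of all `δ` such that `B` has a finite
cover by open sets of diameters `< δ`. It is `∞` for an unbounded set. -/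
def kuratowski (B : Set X) : ℝ≥0∞ :=
  sInf {δ : ℝ≥0∞ | ∃ 𝒰 : Set (Set X), 𝒰.Finite ∧
    (∀ U ∈ 𝒰, IsOpen U ∧ Metric.ediam U < δ) ∧ B ⊆ ⋃₀ 𝒰}

end Dynamics

/-! ### The spatial domain and the function spaces -/

/-- `ℝⁿ` with the Euclidean norm. -/
abbrev Rn (n : ℕ) : Type := EuclideanSpace ℝ (Fin n)

variable {n : ℕ}

/-- `Ω` has a locally Lipschitz boundary: near each boundary point, after a choice of a unit
vector `ν`, it is the set of points lying strictly above the graph of a Lipschitz function `φ`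
over the hyperplane orthogonal to `ν`. (Only the values of `φ` on that hyperplane matter.) -/
def HasLipschitzBoundary (Ω : Set (Rn n)) : Prop :=
  ∀ p ∈ frontier Ω, ∃ U : Set (Rn n), IsOpen U ∧ p ∈ U ∧
    ∃ ν : Rn n, ‖ν‖ = 1 ∧ ∃ (K : NNReal) (φ : Rn n → ℝ), LipschitzWith K φ ∧
      Ω ∩ U = {x ∈ U | φ (x - inner ℝ ν x • ν) < inner ℝ ν x}

/-- A bounded domain (nonempty, open, connected) with locally Lipschitz boundary. -/
structure IsLipschitzDomain (Ω : TopologicalSpace.Opens (Rn n)) : Prop where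
  isConnected : IsConnected (Ω : Set (Rn n))
  isBounded : Bornology.IsBounded (Ω : Set (Rn n))
  boundary : HasLipschitzBoundary (Ω : Set (Rn n))

/-- Lebesgue measure on `Ω`. -/
abbrev vol (Ω : TopologicalSpace.Opens (Rn n)) : Measure (Rn n) :=
  volume.restrict (Ω : Set (Rn n))

/-- `L²(Ω)`. -/
abbrev L2 (Ω : TopologicalSpace.Opens (Rn n)) : Type := Lp ℝ 2 (vol Ω)

/-- `L²(Ω; ℝⁿ)`, the space of gradients. -/
abbrev L2Vec (Ω : TopologicalSpace.Opens (Rn n)) : Type := Lp (Rn n) 2 (vol Ω)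

/-- The Hilbert space `H = L²(Ω)⁴`; the components `0, 1, 2, 3` are `u, v, w, z`. -/
abbrev Phase (Ω : TopologicalSpace.Opens (Rn n)) : Type := PiLp 2 (fun _ : Fin 4 => L2 Ω)

/-- `f ∈ H¹₀(Ω)` with gradient `G`: the pair `(f, G)` is an `L²`-limit of pairs `(φₖ, ∇φₖ)` with
`φₖ ∈ C_c^∞(Ω)`. -/
def HasH10Gradient (Ω : TopologicalSpace.Opens (Rn n)) (f : L2 Ω) (G : L2Vec Ω) : Prop :=
  ∃ φ : ℕ → TestFunction Ω ℝ ⊤,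
    Tendsto (fun k => eLpNorm (fun x => φ k x - f x) 2 (vol Ω)) atTop (𝓝 0) ∧
    Tendsto (fun k => eLpNorm (fun x => gradient (φ k) x - G x) 2 (vol Ω)) atTop (𝓝 0)

/-- `h ∈ L²(Ω)` is the weak divergence of the vector field `G`. If `G = ∇f`, this says that
`h = Δf` weakly. -/
def HasWeakDiv (Ω : TopologicalSpace.Opens (Rn n)) (G : L2Vec Ω) (h : L2 Ω) : Prop :=
  ∀ ψ : TestFunction Ω ℝ ⊤,
    ∫ x, inner ℝ (G x) (gradient ψ x) ∂(vol Ω) = -∫ x, h x * ψ x ∂(vol Ω)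

/-! ### The coupled Brusselator equations -/

/-- The diffusion coefficients of the four equations. -/
def diffusion (d₁ d₂ : ℝ) : Fin 4 → ℝ := ![d₁, d₂, d₁, d₂]

/-- The reaction and coupling terms, as functions of the values `g = (u, v, w, z)`. -/
def reaction (a b D₁ D₂ : ℝ) (g : Fin 4 → ℝ) : Fin 4 → ℝ :=
  let u := g 0
  let v := g 1
  let w := g 2
  let z := g 3
  ![a - (b + 1) * u + u ^ 2 * v + D₁ * (w - u),
    b * u - u ^ 2 * v + D₂ * (z - v),
    a - (b + 1) * w + w ^ 2 * z + D₁ * (u - w),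
    b * w - w ^ 2 * z + D₂ * (v - z)]

/-- `g : [0, ∞) → H` is a global strong solution of `dg/dt = A g + F(g)`, `g(0) = g₀`, with
homogeneous Dirichlet boundary condition, of class
`C([0, ∞); H) ∩ C¹((0, ∞); H) ∩ L²(0, T; H¹₀(Ω)⁴)` for every `T > 0`. For each `t > 0` the
components of `g(t)` lie in `H¹₀(Ω)`, have Laplacians in `L²(Ω)`, and the equation holds in `H`
(so that its nonlinear terms are in `L²(Ω)`, too). -/
structure IsStrongSolution (Ω : TopologicalSpace.Opens (Rn n)) (d₁ d₂ a b D₁ D₂ : ℝ)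
    (g₀ : Phase Ω) (g : ℝ → Phase Ω) : Prop where
  initial : g 0 = g₀
  continuousOn : ContinuousOn g (Ici 0)
  contDiffOn : ContDiffOn ℝ 1 g (Ioi 0)
  equation : ∃ (G : ℝ → Fin 4 → L2Vec Ω) (L : ℝ → Fin 4 → L2 Ω),
    (∀ t, 0 < t → ∀ i, HasH10Gradient Ω (g t i) (G t i)) ∧
    (∀ T : ℝ, 0 < T → ∫⁻ t in Ioc 0 T, ∑ i, ‖G t i‖ₑ ^ 2 < ∞) ∧
    (∀ t, 0 < t → ∀ i, HasWeakDiv Ω (G t i) (L t i)) ∧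
    ∀ t, 0 < t → ∀ i, ∀ᵐ x ∂(vol Ω),
      (deriv g t i) x
        = diffusion d₁ d₂ i * L t i x + reaction a b D₁ D₂ (fun j => g t j x) i

/-- `S` is the coupled Brusselator semiflow: a semiflow on `H` whose orbits are the global strong
solutions of the coupled Brusselator evolutionary equation. -/
structure IsBrusselatorSemiflow (Ω : TopologicalSpace.Opens (Rn n)) (d₁ d₂ a b D₁ D₂ : ℝ)
    (S : ℝ → Phase Ω → Phase Ω) : Prop where
  isSemiflow : IsSemiflow S
  isSolution : ∀ g₀, IsStrongSolution Ω d₁ d₂ a b D₁ D₂ g₀ (fun t => S t g₀)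

/-! ### Truncation -/

/-- The product of `f ∈ L²(Ω)` with the characteristic function of `Ω(|φ| < M)`. -/
def trunc {Ω : TopologicalSpace.Opens (Rn n)} (φ : L2 Ω) (M : ℝ) (f : L2 Ω) : L2 Ω :=
  ((Lp.memLp f).indicator
    (measurableSet_lt (Lp.stronglyMeasurable φ).measurable.abs measurable_const :
      MeasurableSet {x | |φ x| < M})).toLp _

/-- `(S(t)B₀)_{Ω(|φ(t)| < M)}`, where `φ` is the `i`-th component of the solution: all products
of `S(t)g₀`, `g₀ ∈ B₀`, with the characteristic function of `Ω(|φ(t)| < M)`. -/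
def truncatedImage {Ω : TopologicalSpace.Opens (Rn n)} (S : ℝ → Phase Ω → Phase Ω)
    (B₀ : Set (Phase Ω)) (i : Fin 4) (M t : ℝ) : Set (Phase Ω) :=
  (fun g₀ => WithLp.toLp 2 (fun j => trunc (S t g₀ i) M (S t g₀ j))) '' B₀

/-- The orthogonal projection of `H` onto the product `L²(Ω) × L²(Ω)` of the `i`-th and the
`j`-th component space. -/
def proj {Ω : TopologicalSpace.Opens (Rn n)} (i j : Fin 4) (g : Phase Ω) :
    WithLp 2 (L2 Ω × L2 Ω) :=
  WithLp.toLp 2 (g i, g j)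

end Brusselator

end

/-! A state splits into its truncation, where (u, v) is cut off on |v| ≥ M and (w, z) on |z| ≥ M,
and a tail. By (ii), some M makes the tail uniformly small in H at all late times. For that M, (iii)
yields a late time at which both truncated pairs have finite covers by sets of small diameter.
States in the same two pieces are then close, so a single image of B₀ has a finite net of the
prescribed mesh (`exists_finite_net_of_trunc`).

Every later image of B₀ eventually enters that one, so sequences S(tₖ)yₖ with tₖ → ∞ are totally
bounded, and completeness gives convergent subsequences (`exists_subseq_tendsto`). The ω-limit set
of B₀ is then the attractor (`isGlobalAttractor_omegaSet`). -/

namespace Brusselator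

/-! ### Global attractors of asymptotically compact semiflows -/

section Attractor

variable {X : Type*} [NormedAddCommGroup X]

/-- If a set can be sorted into finitely many classes, by membership in the pieces of two finite
covers, such that elements of the same class have images at distance less than `ε`, then the image
has a finite `ε`-net. -/
theorem exists_finite_net_of_covers {α Y Z : Type*} {B : Set α} {f : α → X} {p : α → Y}
    {q : α → Z} {𝒰 : Set (Set Y)} {𝒱 : Set (Set Z)} (h𝒰 : 𝒰.Finite) (h𝒱 : 𝒱.Finite)
    (hp : ∀ g ∈ B, ∃ U ∈ 𝒰, p g ∈ U) (hq : ∀ g ∈ B, ∃ V ∈ 𝒱, q g ∈ V) {ε : ℝ}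
    (h : ∀ U ∈ 𝒰, ∀ V ∈ 𝒱, ∀ g ∈ B, ∀ g' ∈ B, p g ∈ U → p g' ∈ U → q g ∈ V → q g' ∈ V →
      dist (f g) (f g') < ε) :
    ∃ F : Set X, F.Finite ∧ f '' B ⊆ ⋃ y ∈ F, Metric.ball y ε := by
  classical
  let C : Set Y × Set Z → Set α := fun c => {g ∈ B | p g ∈ c.1 ∧ q g ∈ c.2}
  -- One representative per class serves as a centre; the value 0 for empty classes only makes `r`
  -- total.
  let r : Set Y × Set Z → X := fun c => if hc : (C c).Nonempty then f hc.some else 0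
  refine ⟨r '' (𝒰 ×ˢ 𝒱), (h𝒰.prod h𝒱).image r, ?_⟩
  rintro _ ⟨g, hg, rfl⟩
  obtain ⟨U, hU, hgU⟩ := hp g hg
  obtain ⟨V, hV, hgV⟩ := hq g hg
  have hc : (C (U, V)).Nonempty := ⟨g, hg, hgU, hgV⟩
  refine mem_biUnion (mem_image_of_mem r (mk_mem_prod hU hV)) ?_
  have hr : r (U, V) = f hc.some := dif_pos hc
  obtain ⟨h1, h2, h3⟩ := hc.some_mem
  rw [Metric.mem_ball, hr]
  exact h U hU V hV g hg _ h1 hgU h2 hgV h3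

/-- The points that are limits of `S tₖ xₖ` with `tₖ → ∞` and `xₖ ∈ B`. -/
def omegaSet (S : ℝ → X → X) (B : Set X) : Set X :=
  {x | ∃ (t : ℕ → ℝ) (y : ℕ → X), Tendsto t atTop atTop ∧ (∀ k, y k ∈ B) ∧
    Tendsto (fun k => S (t k) (y k)) atTop (𝓝 x)}

/-- Late images of an absorbing set lie in any given image of it. -/
theorem IsSemiflow.exists_image_subset {S : ℝ → X → X} (hS : IsSemiflow S) {B₀ : Set X}
    (hB : IsAbsorbing S B₀) {s : ℝ} (hs : 0 ≤ s) :
    ∃ T : ℝ, ∀ t, T < t → ∀ x ∈ B₀, S t x ∈ S s '' B₀ := by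
  obtain ⟨t₀, ht₀, h⟩ := hB.2 B₀ hB.1
  refine ⟨s + t₀, fun t ht x hx => ⟨S (t - s) x, ?_, ?_⟩⟩
  · exact h (t - s) (by linarith) (mem_image_of_mem _ hx)
  · rw [← hS.map_add s (t - s) hs (by linarith)]
    congr 1
    ring

variable {S : ℝ → X → X} {B₀ : Set X}

/-- Carries finite nets from the images of `B₀` over to the ω-limit set. -/
theorem omegaSet_subset_closure (hS : IsSemiflow S) (hB : IsAbsorbing S B₀) {s : ℝ}
    (hs : 0 ≤ s) : omegaSet S B₀ ⊆ closure (S s '' B₀) := by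
  rintro x ⟨t, y, ht, hy, hx⟩
  obtain ⟨T, hT⟩ := hS.exists_image_subset hB hs
  refine mem_closure_of_tendsto hx ?_
  filter_upwards [ht.eventually_gt_atTop T] with k hk using hT _ hk _ (hy k)

theorem isClosed_omegaSet : IsClosed (omegaSet S B₀) := by
  refine isClosed_of_closure_subset fun x hx => ?_
  have key : ∀ k : ℕ, ∃ t : ℝ, ∃ y ∈ B₀, (k : ℝ) ≤ t ∧ dist (S t y) x < 1 / ((k : ℝ) + 1) := by
    intro k
    have hk : (0 : ℝ) < 1 / ((k : ℝ) + 1) := by positivity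
    obtain ⟨z, ⟨t, y, ht, hy, hz⟩, hxz⟩ := Metric.mem_closure_iff.1 hx _ (half_pos hk)
    obtain ⟨j, hj, hj'⟩ := ((ht.eventually_ge_atTop (k : ℝ)).and
      (Metric.tendsto_nhds.1 hz _ (half_pos hk))).exists
    refine ⟨t j, y j, hy j, hj, ?_⟩
    have := dist_triangle (S (t j) (y j)) z x
    rw [dist_comm x z] at hxz
    linarith
  choose t y hy ht hd using key
  refine ⟨t, y, tendsto_atTop_mono ht tendsto_natCast_atTop_atTop, hy, ?_⟩
  exact tendsto_iff_dist_tendsto_zero.2 (squeeze_zero (fun _ => dist_nonneg)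
    (fun k => (hd k).le) tendsto_one_div_add_atTop_nhds_zero_nat)

variable [CompleteSpace X]

/-- Asymptotic compactness: if the images of an absorbing set have finite nets of arbitrarily small
mesh, then `S tₖ yₖ` has a convergent subsequence whenever `tₖ → ∞` and `yₖ ∈ B₀`. -/
theorem exists_subseq_tendsto (hS : IsSemiflow S) (hB : IsAbsorbing S B₀)
    (hnet : ∀ ε : ℝ, 0 < ε → ∃ s : ℝ, 0 ≤ s ∧ ∃ F : Set X, F.Finite ∧
      S s '' B₀ ⊆ ⋃ y ∈ F, Metric.ball y ε)
    {t : ℕ → ℝ} {y : ℕ → X} (ht : Tendsto t atTop atTop) (hy : ∀ k, y k ∈ B₀) :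
    ∃ x ∈ omegaSet S B₀, ∃ φ : ℕ → ℕ, StrictMono φ ∧
      Tendsto (fun k => S (t (φ k)) (y (φ k))) atTop (𝓝 x) := by
  have htb : TotallyBounded (range fun k => S (t k) (y k)) := by
    refine Metric.totallyBounded_iff.2 fun ε hε => ?_
    obtain ⟨s, hs, F, hF, hcov⟩ := hnet ε hε
    obtain ⟨T, hT⟩ := hS.exists_image_subset hB hs
    obtain ⟨N, hN⟩ := eventually_atTop.1 (ht.eventually_gt_atTop T)
    -- The finitely many terms that come too early to lie in `S s '' B₀` are added as their own
    -- centres.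
    refine ⟨F ∪ (fun k => S (t k) (y k)) '' Iio N, hF.union ((finite_Iio N).image _), ?_⟩
    rintro _ ⟨k, rfl⟩
    rcases lt_or_ge k N with hk | hk
    · exact mem_biUnion (Or.inr (mem_image_of_mem _ hk)) (Metric.mem_ball_self hε)
    · exact biUnion_subset_biUnion_left subset_union_left (hcov (hT _ (hN k hk) _ (hy k)))
  have hc : IsCompact (closure (range fun k => S (t k) (y k))) :=
    htb.closure.isCompact_of_isClosed isClosed_closure
  obtain ⟨x, -, φ, hφ, hx⟩ := hc.tendsto_subseq
    (x := fun k => S (t k) (y k)) fun k => subset_closure (mem_range_self k)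
  exact ⟨x, ⟨fun k => t (φ k), fun k => y (φ k), ht.comp hφ.tendsto_atTop, fun k => hy _, hx⟩,
    φ, hφ, hx⟩

/-- A semiflow on a complete space with a bounded absorbing set, whose images have finite nets of
arbitrarily small mesh, has a global attractor. -/
theorem isGlobalAttractor_omegaSet (hS : IsSemiflow S) (hB : IsAbsorbing S B₀)
    (hnet : ∀ ε : ℝ, 0 < ε → ∃ s : ℝ, 0 ≤ s ∧ ∃ F : Set X, F.Finite ∧
      S s '' B₀ ⊆ ⋃ y ∈ F, Metric.ball y ε) :
    IsGlobalAttractor S (omegaSet S B₀) where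
  nonempty := by
    -- Absorbing the orbit of 0 shows that `B₀` has a point; time `t₀ + 1` because absorption is
    -- strict in `t₀`.
    obtain ⟨t₀, -, h⟩ := hB.2 {0} Bornology.isBounded_singleton
    have h0 : S (t₀ + 1) 0 ∈ B₀ := h _ (by linarith) (mem_image_of_mem _ rfl)
    obtain ⟨x, hx, -⟩ := exists_subseq_tendsto hS hB hnet (t := fun k => (k : ℝ))
      tendsto_natCast_atTop_atTop (fun _ => h0)
    exact ⟨x, hx⟩
  isCompact := by
    refine TotallyBounded.isCompact_of_isClosed (Metric.totallyBounded_iff.2 fun ε hε => ?_)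
      isClosed_omegaSet
    obtain ⟨s, hs, F, hF, hcov⟩ := hnet (ε / 2) (half_pos hε)
    refine ⟨F, hF, fun x hx => ?_⟩
    obtain ⟨z, hz, hxz⟩ := Metric.mem_closure_iff.1 (omegaSet_subset_closure hS hB hs hx) _
      (half_pos hε)
    obtain ⟨y, hy, hzy⟩ := mem_iUnion₂.1 (hcov hz)
    refine mem_biUnion hy (Metric.mem_ball.2 ?_)
    have := dist_triangle x z y
    rw [Metric.mem_ball] at hzy
    linarith
  invariant := by
    intro τ hτ
    refine Subset.antisymm ?_ ?_
    · rintro _ ⟨x, ⟨t, y, ht, hy, hx⟩, rfl⟩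
      refine ⟨fun k => τ + t k, y, tendsto_atTop_add_const_left _ _ ht, hy, ?_⟩
      refine (((hS.continuous_space τ hτ).tendsto x).comp hx).congr' ?_
      filter_upwards [ht.eventually_ge_atTop 0] with k hk
      exact (hS.map_add τ (t k) hτ hk _).symm
    · rintro x ⟨t, y, ht, hy, hx⟩
      -- Negative invariance: a limit point `z` of the states a time `τ` earlier is sent by `S τ` to
      -- `x`, by continuity.
      have ht' : Tendsto (fun k => t k - τ) atTop atTop :=
        tendsto_atTop_add_const_right _ (-τ) ht
      obtain ⟨z, hz, φ, hφ, hlim⟩ := exists_subseq_tendsto hS hB hnet ht' hy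
      refine ⟨z, hz, tendsto_nhds_unique (((hS.continuous_space τ hτ).tendsto z).comp hlim) ?_⟩
      refine (hx.comp hφ.tendsto_atTop).congr' ?_
      filter_upwards [(ht'.comp hφ.tendsto_atTop).eventually_ge_atTop 0] with k hk
      simp only [Function.comp_apply] at hk ⊢
      rw [← hS.map_add τ _ hτ hk]
      congr 1
      ring
  attracts := by
    intro B hBb
    -- If attraction of `B₀` failed, states staying away from the ω-limit set at times tending to
    -- infinity would have a subsequence converging into it.
    have hB₀ : ∀ ε : ℝ≥0∞, 0 < ε → ∃ T : ℝ, ∀ t, T ≤ t → ∀ x ∈ B₀,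
        Metric.infEDist (S t x) (omegaSet S B₀) ≤ ε := by
      intro ε hε
      by_contra! hcon
      choose t ht y hy hd using fun k : ℕ => hcon (k : ℝ)
      obtain ⟨x, hx, φ, hφ, hlim⟩ := exists_subseq_tendsto hS hB hnet
        (tendsto_atTop_mono ht tendsto_natCast_atTop_atTop) hy
      obtain ⟨k, hk⟩ := (hlim.eventually (Metric.eball_mem_nhds x hε)).exists
      exact absurd ((Metric.infEDist_le_edist_of_mem hx).trans hk.le) (hd _).not_ge
    obtain ⟨t₀, ht₀, habs⟩ := hB.2 B hBb
    refine ENNReal.tendsto_nhds_zero.2 fun ε hε => ?_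
    obtain ⟨T, hT⟩ := hB₀ ε hε
    filter_upwards [eventually_ge_atTop (T + (t₀ + 1)), eventually_ge_atTop (t₀ + 1)]
      with t h1 h2
    refine iSup₂_le ?_
    rintro _ ⟨x, hx, rfl⟩
    have hx₀ : S (t₀ + 1) x ∈ B₀ := habs _ (by linarith) (mem_image_of_mem _ hx)
    have := hT (t - (t₀ + 1)) (by linarith) _ hx₀
    rwa [← hS.map_add _ _ (by linarith) (by linarith), sub_add_cancel] at this

end Attractor

theorem exists_cover_of_kuratowski_lt {X : Type*} [NormedAddCommGroup X] {B : Set X} {δ : ℝ≥0∞}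
    (h : kuratowski B < δ) :
    ∃ 𝒰 : Set (Set X), 𝒰.Finite ∧ (∀ U ∈ 𝒰, Metric.ediam U < δ) ∧ B ⊆ ⋃₀ 𝒰 := by
  obtain ⟨δ', ⟨𝒰, hfin, hU, hcov⟩, hδ⟩ := sInf_lt_iff.1 h
  exact ⟨𝒰, hfin, fun U hU' => (hU U hU').2.trans hδ, hcov⟩

/-! ### Truncation and finite nets in the phase space -/

variable {n : ℕ} {Ω : TopologicalSpace.Opens (Rn n)}

/-- The squared norm of what truncation removes is the integral over the removed set. -/
theorem norm_sub_trunc_sq (φ f : L2 Ω) (M : ℝ) :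
    ‖f - trunc φ M f‖ ^ 2
      = ∫ x in {x ∈ (Ω : Set (Rn n)) | M ≤ |φ x|}, |f x| ^ 2 := by
  have hφ : Measurable fun x => |φ x| := (Lp.stronglyMeasurable φ).measurable.abs
  have hms : MeasurableSet {x | M ≤ |φ x|} := measurableSet_le measurable_const hφ
  have hset : {x ∈ (Ω : Set (Rn n)) | M ≤ |φ x|} = {x | M ≤ |φ x|} ∩ (Ω : Set (Rn n)) := by
    ext x
    exact and_comm
  rw [← real_inner_self_eq_norm_sq, L2.inner_def, hset, ← Measure.restrict_restrict hms,
    ← integral_indicator hms]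
  refine integral_congr_ae ?_
  have htr : trunc φ M f =ᵐ[vol Ω] indicator {x | |φ x| < M} f := MemLp.coeFn_toLp _
  filter_upwards [Lp.coeFn_sub f (trunc φ M f), htr] with x h1 h2
  rw [h1, Pi.sub_apply, h2, real_inner_self_eq_norm_sq, Real.norm_eq_abs]
  by_cases hx : |φ x| < M
  · rw [indicator_of_mem (show x ∈ {x | |φ x| < M} from hx),
      indicator_of_notMem (show x ∉ {x | M ≤ |φ x|} from not_le.2 hx)]
    simp
  · rw [indicator_of_notMem (show x ∉ {x | |φ x| < M} from hx),
      indicator_of_mem (show x ∈ {x | M ≤ |φ x|} from not_lt.1 hx)]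
    simp

theorem norm_phase_sq (g : Phase Ω) :
    ‖g‖ ^ 2 = ‖g 0‖ ^ 2 + ‖g 1‖ ^ 2 + ‖g 2‖ ^ 2 + ‖g 3‖ ^ 2 := by
  rw [PiLp.norm_sq_eq_of_L2, Fin.sum_univ_four]

theorem norm_proj_sub_sq (i j : Fin 4) (g h : Phase Ω) :
    ‖proj i j g - proj i j h‖ ^ 2 = ‖g i - h i‖ ^ 2 + ‖g j - h j‖ ^ 2 := by
  rw [WithLp.prod_norm_sq_eq_of_L2]
  rfl

/-- The state whose first two components are cut off where `|v| ≥ M`, and whose last two components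
are cut off where `|z| ≥ M`. -/
noncomputable def truncState (M : ℝ) (g : Phase Ω) : Phase Ω :=
  WithLp.toLp 2 ![trunc (g 1) M (g 0), trunc (g 1) M (g 1), trunc (g 3) M (g 2),
    trunc (g 3) M (g 3)]

theorem norm_sub_truncState_sq (M : ℝ) (g : Phase Ω) :
    ‖g - truncState M g‖ ^ 2 =
      ‖g 0 - trunc (g 1) M (g 0)‖ ^ 2 + ‖g 1 - trunc (g 1) M (g 1)‖ ^ 2
        + ‖g 2 - trunc (g 3) M (g 2)‖ ^ 2 + ‖g 3 - trunc (g 3) M (g 3)‖ ^ 2 :=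
  norm_phase_sq _

theorem norm_phase_sub_sq_eq_proj (g h : Phase Ω) :
    ‖g - h‖ ^ 2 = ‖proj 0 1 g - proj 0 1 h‖ ^ 2 + ‖proj 2 3 g - proj 2 3 h‖ ^ 2 := by
  rw [norm_proj_sub_sq, norm_proj_sub_sq, norm_phase_sq]
  simp only [PiLp.sub_apply]
  ring

/-- `truncatedImage` cuts all four components by one cutoff, `truncState` uses two; they agree on
the pair that is projected. -/
theorem proj_truncState_mem_left {S : ℝ → Phase Ω → Phase Ω} {B₀ : Set (Phase Ω)} {M t : ℝ}
    {g : Phase Ω} (hg : g ∈ B₀) :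
    proj 0 1 (truncState M (S t g)) ∈ proj 0 1 '' truncatedImage S B₀ 1 M t :=
  ⟨_, ⟨g, hg, rfl⟩, rfl⟩

theorem proj_truncState_mem_right {S : ℝ → Phase Ω → Phase Ω} {B₀ : Set (Phase Ω)} {M t : ℝ}
    {g : Phase Ω} (hg : g ∈ B₀) :
    proj 2 3 (truncState M (S t g)) ∈ proj 2 3 '' truncatedImage S B₀ 3 M t :=
  ⟨_, ⟨g, hg, rfl⟩, rfl⟩

/-- If the tails of the states in `S t '' B₀` are small and the truncated parts have small
measure of noncompactness, then `S t '' B₀` has a finite net of small mesh. -/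
theorem exists_finite_net_of_trunc {S : ℝ → Phase Ω → Phase Ω} {B₀ : Set (Phase Ω)}
    {M t ε : ℝ} (hε : 0 < ε)
    (htail : ∀ g ∈ B₀, ‖S t g - truncState M (S t g)‖ < ε)
    (hleft : kuratowski (proj 0 1 '' truncatedImage S B₀ 1 M t) < ENNReal.ofReal ε)
    (hright : kuratowski (proj 2 3 '' truncatedImage S B₀ 3 M t) < ENNReal.ofReal ε) :
    ∃ F : Set (Phase Ω), F.Finite ∧ S t '' B₀ ⊆ ⋃ y ∈ F, Metric.ball y (4 * ε) := by
  obtain ⟨𝒰, h𝒰, hdU, hcU⟩ := exists_cover_of_kuratowski_lt hleft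
  obtain ⟨𝒱, h𝒱, hdV, hcV⟩ := exists_cover_of_kuratowski_lt hright
  have hdist : ∀ {Y : Type} [NormedAddCommGroup Y] {U : Set Y} {x y : Y},
      Metric.ediam U < ENNReal.ofReal ε → x ∈ U → y ∈ U → ‖x - y‖ < ε := by
    intro Y _ U x y hU hx hy
    have := (Metric.edist_le_ediam_of_mem hx hy).trans_lt hU
    rwa [edist_dist, ENNReal.ofReal_lt_ofReal_iff hε, dist_eq_norm] at this
  refine exists_finite_net_of_covers h𝒰 h𝒱 (p := fun g => proj 0 1 (truncState M (S t g)))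
    (q := fun g => proj 2 3 (truncState M (S t g)))
    (fun g hg => hcU (proj_truncState_mem_left hg))
    (fun g hg => hcV (proj_truncState_mem_right hg)) ?_
  intro U hU V hV g hg g' hg' h1 h2 h3 h4
  have hl := hdist (hdU U hU) h1 h2
  have hr := hdist (hdV V hV) h3 h4
  -- Orthogonality of the two pairs gives √2 ε; the bound 2ε is enough, and two tails bring the
  -- total to 4ε.
  have hmid : ‖truncState M (S t g) - truncState M (S t g')‖ < 2 * ε := by
    refine lt_of_pow_lt_pow_left₀ 2 (by positivity) ?_
    rw [norm_phase_sub_sq_eq_proj]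
    have hl' := pow_lt_pow_left₀ hl (norm_nonneg _) two_ne_zero
    have hr' := pow_lt_pow_left₀ hr (norm_nonneg _) two_ne_zero
    nlinarith
  have h5 := htail g hg
  have h6 := htail g' hg'
  have h7 := dist_triangle4 (S t g) (truncState M (S t g)) (truncState M (S t g')) (S t g')
  rw [← dist_eq_norm] at h5 h6 hmid
  rw [dist_comm] at h6
  linarith

end Brusselator

theorem lemma5 (n : ℕ) (hn1 : 1 ≤ n) (hn3 : n ≤ 3)
    (Ω : TopologicalSpace.Opens (Brusselator.Rn n)) (hΩ : Brusselator.IsLipschitzDomain Ω)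
    (d₁ d₂ a b D₁ D₂ : ℝ) (hd₁ : 0 < d₁) (hd₂ : 0 < d₂) (ha : 0 < a) (hb : 0 < b)
    (hD₁ : 0 < D₁) (hD₂ : 0 < D₂)
    (S : ℝ → Brusselator.Phase Ω → Brusselator.Phase Ω)
    (hS : Brusselator.IsBrusselatorSemiflow Ω d₁ d₂ a b D₁ D₂ S)
    (B₀ : Set (Brusselator.Phase Ω))
    -- (i) bounded absorbing set
    (h_i : Brusselator.IsAbsorbing S B₀)
    -- (ii) uniformly small tails; the components 0, 1, 2, 3 are u, v, w, z
    (h_ii : ∃ L₁ L₂ : ℝ, 0 < L₁ ∧ 0 < L₂ ∧ ∀ ε : ℝ, 0 < ε → ∃ M T : ℝ, 0 < M ∧ 0 < T ∧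
      ∀ t : ℝ, T < t → ∀ g₀ ∈ B₀,
        ((∫ x in {x ∈ (Ω : Set (Brusselator.Rn n)) | M ≤ |S t g₀ 1 x|}, |S t g₀ 1 x| ^ 2)
          + (∫ x in {x ∈ (Ω : Set (Brusselator.Rn n)) | M ≤ |S t g₀ 3 x|}, |S t g₀ 3 x| ^ 2)
            < L₁ * ε) ∧
        ((∫ x in {x ∈ (Ω : Set (Brusselator.Rn n)) | M ≤ |S t g₀ 1 x|}, |S t g₀ 0 x| ^ 2)
          + (∫ x in {x ∈ (Ω : Set (Brusselator.Rn n)) | M ≤ |S t g₀ 3 x|}, |S t g₀ 2 x| ^ 2)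
            < L₂ * ε))
    -- (iii) asymptotic compactness of the truncated parts
    (h_iii : ∀ M : ℝ, 0 < M →
      Tendsto (fun t : ℝ => Brusselator.kuratowski
        (Brusselator.proj 0 1 '' Brusselator.truncatedImage S B₀ 1 M t)) atTop (𝓝 0) ∧
      Tendsto (fun t : ℝ => Brusselator.kuratowski
        (Brusselator.proj 2 3 '' Brusselator.truncatedImage S B₀ 3 M t)) atTop (𝓝 0)) :
    ∃ A : Set (Brusselator.Phase Ω), Brusselator.IsGlobalAttractor S A := by
  refine ⟨_, Brusselator.isGlobalAttractor_omegaSet hS.isSemiflow h_i fun ε hε => ?_⟩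
  obtain ⟨L₁, L₂, hL₁, hL₂, h_ii⟩ := h_ii
  have hη : 0 < ε / 4 := by positivity
  -- With this parameter the two tail bounds add up to exactly `(ε / 4) ^ 2`. `M` is fixed before
  -- `t`, since the decay in (iii) may depend on `M`.
  obtain ⟨M, T, hM, hT, htail⟩ := h_ii ((ε / 4) ^ 2 / (L₁ + L₂)) (by positivity)
  have hδ : (0 : ℝ≥0∞) < ENNReal.ofReal (ε / 4) := ENNReal.ofReal_pos.2 hη
  obtain ⟨t, ht, hleft, hright⟩ := ((eventually_gt_atTop T).and
    (((h_iii M hM).1.eventually_lt_const hδ).and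
      ((h_iii M hM).2.eventually_lt_const hδ))).exists
  refine ⟨t, (hT.trans ht).le, ?_⟩
  rw [show ε = 4 * (ε / 4) by ring]
  refine Brusselator.exists_finite_net_of_trunc hη (fun g hg => ?_) hleft hright
  obtain ⟨h1, h2⟩ := htail t ht g hg
  refine lt_of_pow_lt_pow_left₀ 2 hη.le ?_
  rw [Brusselator.norm_sub_truncState_sq]
  simp only [← Brusselator.norm_sub_trunc_sq] at h1 h2
  have hsum : L₁ * ((ε / 4) ^ 2 / (L₁ + L₂)) + L₂ * ((ε / 4) ^ 2 / (L₁ + L₂)) = (ε / 4) ^ 2 := by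
    field_simp
  linarith
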